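/- All graphs are finite and simple; $\cong$ denotes graph isomorphism. For a graph $G$ let $L(G)=D(G)-A(G)$ be its Laplacian matrix and $\operatorname{per}$ the permanent. A unicyclic graph on $n$ vertices is a connected graph with $n$ vertices and $n$ edges; let $\mathscr U_n$ be the set of all bipartite unicyclic graphs on $n$ vertices. For integers $s_i\ge 0$, $k_i\ge 0$, let $C_4(1^{s_1}k_1,1^{s_2}k_2,1^{s_3}k_3,1^{s_4}k_4)$ be the graph obtained from the cycle $v_1v_2v_3v_4v_1$ by attaching $s_i$ pendant vertices at $v_i$ and, if $k_i\ge 1$, joining $v_i$ by an edge to the center of a (new) star with $k_i$ vertices, $i=1,2,3,4$. For $p,q\ge 2$ put $B(p,q)=C_4(1^{p-2}0,1^{q-2}0,1^00,1^00)$. Theorem 3.9. Let $n\ge 4$. 1. $B(2,n-2)\in\mathscr U_n$ and $\operatorname{per}L(B(2,n-2))=24n-60$. For every $G\in\mathscr U_n$ one has $\operatorname{per}L(G)\ge 24n-60$, with equality if and only if $G\cong B(2,n-2)$. 2. If $n\ge 6$, then $C_4(1^10,1^00,1^{n-5}0,1^00)\in\mathscr U_n$, it is not isomorphic to $B(2,n-2)$,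 and the permanent of its Laplacian matrix is $40n-140$. For every $G\in\mathscr U_n$ with $G\not\cong B(2,n-2)$ one has $\operatorname{per}L(G)\ge 40n-140$, with equality if and only if $G\cong C_4(1^10,1^00,1^{n-5}0,1^00)$. 3. If $n\ge 6$, then $B(3,n-3)\in\mathscr U_n$, it is isomorphic neither to $B(2,n-2)$ nor to $C_4(1^10,1^00,1^{n-5}0,1^00)$, and $\operatorname{per}L(B(3,n-3))=44n-160$. For every $G\in\mathscr U_n$ with $G\not\cong B(2,n-2)$ and $G\not\cong C_4(1^10,1^00,1^{n-5}0,1^00)$ one has $\operatorname{per}L(G)\ge 44n-160$, with equality if and only if $G\cong B(3,n-3)$. -/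

import Mathlib

universe u

/-- The permanent of the Laplacian matrix `L(G) = D(G) - A(G)` (with integer entries). -/
noncomputable def lapPer {V : Type*} [Fintype V] (G : SimpleGraph V) : ℤ := by
  classical exact (G.lapMatrix ℤ).permanent

/-- `G` is a bipartite unicyclic graph on `n` vertices: a connected bipartite simple graph
with `n` vertices and `n` edges. -/
structure IsBipartiteUnicyclic (n : ℕ) {V : Type*} (G : SimpleGraph V) : Prop where
  card_vertices : Nat.card V = n
  card_edges : Nat.card G.edgeSet = n
  connected : G.Connected
  bipartite : G.IsBipartite

/-- Vertices of the graph `C₄(1^{s₁}k₁, …, 1^{s₄}k₄)`: the four cycle vertices, then `s i`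
pendant vertices for each `i`, then the `k i` vertices of a star for each `i`. -/
abbrev C4Vertex (s k : Fin 4 → ℕ) : Type :=
  Fin 4 ⊕ ((i : Fin 4) × Fin (s i)) ⊕ ((i : Fin 4) × Fin (k i))

/-- The edges of `C₄(1^{s₁}k₁, …, 1^{s₄}k₄)`, each listed in at least one orientation. -/
def C4Rel (s k : Fin 4 → ℕ) : C4Vertex s k → C4Vertex s k → Prop
  -- the cycle itself
  | .inl i, .inl j => (SimpleGraph.cycleGraph 4).Adj i j
  -- the `i`-th cycle vertex is joined to its `s i` pendant vertices
  | .inl i, .inr (.inl ⟨j, _⟩) => i = j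
  -- the `i`-th cycle vertex is joined to the center (vertex `0`) of its star
  | .inl i, .inr (.inr ⟨j, a⟩) => i = j ∧ a.val = 0
  -- within a star, the center is joined to all other vertices
  | .inr (.inr ⟨i, a⟩), .inr (.inr ⟨j, b⟩) => i = j ∧ a.val = 0 ∧ b.val ≠ 0
  | _, _ => False

/-- `C₄(1^{s₁}k₁, 1^{s₂}k₂, 1^{s₃}k₃, 1^{s₄}k₄)`: the graph obtained from the 4-cycle
`v₁v₂v₃v₄v₁` by attaching `sᵢ` pendant vertices at `vᵢ` and joining `vᵢ` by an edge to the
center of a star on `kᵢ` vertices (no star if `kᵢ = 0`). -/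
def C4Graph (s k : Fin 4 → ℕ) : SimpleGraph (C4Vertex s k) :=
  SimpleGraph.fromRel (C4Rel s k)

/-- `B(p, q) = C₄(1^{p-2}0, 1^{q-2}0, 1^0 0, 1^0 0)`, used for `p, q ≥ 2`. -/
abbrev BGraph (p q : ℕ) : SimpleGraph (C4Vertex ![p - 2, q - 2, 0, 0] ![0, 0, 0, 0]) :=
  C4Graph ![p - 2, q - 2, 0, 0] ![0, 0, 0, 0]

/-- `C₄(1^1 0, 1^0 0, 1^{n-5}0, 1^0 0)`, used for `n ≥ 6`. -/
abbrev C4OneGraph (n : ℕ) : SimpleGraph (C4Vertex ![1, 0, n - 5, 0] ![0, 0, 0, 0]) :=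
  C4Graph ![1, 0, n - 5, 0] ![0, 0, 0, 0]

/-! For a bipartite graph the signs of the Laplacian cancel in each permutation product, so `lapPer`
equals the permanent of the entrywise nonnegative matrix Q = D + A
(`lapPer_eq_permanent_signlessLap`). The argument splits on the number of internal vertices, those
of degree at least 2.

With at most four internal vertices, the graph is a four-cycle with pendant vertices
(`exists_isHairyCycle`). Its permanent is an explicit polynomial in the four hair counts
(`permanent_signlessLap_hairyC4`). Comparing this polynomial with 44n - 160, up to symmetries of the
cycle, isolates the three extremal families (`hairyC4_classification`).

With at least five internal vertices, the permanent exceeds 44n - 160, by induction on n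
(`lt_permanent_of_five_le_internal`). Write G as H with a pendant vertex added at v; then per Q(G) =
per Q(H) + 2m, where m is the permanent of Q(H) with row and column v deleted. If v is internal in
H, then m ≥ 22, so the permanent grows by at least 44. If v is pendant in H, it at least doubles. If
G has no pendant vertex, it is 2-regular, and the identity and the transpositions alone suffice.

The three families have different permanents, hence are pairwise non-isomorphic. -/

section

open Finset Equiv

/-! ### Permanents: a pendant border, and lower bounds for nonnegative matrices. -/

namespace Matrix

variable {m n : Type*} [DecidableEq m] [Fintype m] [DecidableEq n] [Fintype n]

theorem permanent_submatrix_equiv (e : m ≃ n) (M : Matrix n n ℤ) :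
    (M.submatrix e e).permanent = M.permanent := by
  unfold permanent
  refine Fintype.sum_equiv e.permCongr _ _ fun σ => ?_
  refine Fintype.prod_equiv e _ _ fun i => ?_
  simp [Equiv.permCongr_apply]

theorem permanent_updateCol_add (M : Matrix n n ℤ) (j : n) (u w : n → ℤ) :
    (M.updateCol j (u + w)).permanent =
      (M.updateCol j u).permanent + (M.updateCol j w).permanent := by
  simp only [permanent, ← mul_prod_erase _ _ (mem_univ j), updateCol_self, Pi.add_apply,
    ← sum_add_distrib, add_mul]
  refine sum_congr rfl fun σ _ => ?_
  congr 2 <;> exact prod_congr rfl fun i hi => by simp [ne_of_mem_erase hi]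

theorem permanent_updateRow_add (M : Matrix n n ℤ) (j : n) (u w : n → ℤ) :
    (M.updateRow j (u + w)).permanent =
      (M.updateRow j u).permanent + (M.updateRow j w).permanent := by
  rw [← permanent_transpose, ← updateCol_transpose, permanent_updateCol_add,
    updateCol_transpose, updateCol_transpose, permanent_transpose, permanent_transpose]

/-- Replacing row v by `Pi.single v 1` has the effect of deleting row and column v while keeping the
index type; minors take this form throughout. -/
theorem permanent_add_single (M : Matrix n n ℤ) (v : n) (a : ℤ) :
    (M + Matrix.single v v a).permanent =
      M.permanent + a * (M.updateRow v (Pi.single v 1)).permanent := by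
  have h1 : M + Matrix.single v v a = M.updateRow v (M v + a • Pi.single v 1) := by
    ext i j
    by_cases hi : i = v
    · subst hi
      by_cases hj : j = i
      · subst hj; simp
      · simp [hj, Ne.symm hj]
    · simp [hi, Ne.symm hi]
  rw [h1, permanent_updateRow_add, updateRow_eq_self, permanent_updateRow_smul]

/-- A nonzero permutation product either fixes `none` or exchanges it with v, since the border has
no other nonzero off-diagonal entries. -/
theorem permanent_option_of_pendant (M : Matrix (Option n) (Option n) ℤ) (v : n) (b c : ℤ)
    (hc : ∀ x, M (some x) none = if x = v then b else 0)
    (hr : ∀ x, M none (some x) = if x = v then c else 0) :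
    M.permanent = M none none * (M.submatrix some some).permanent +
      b * c * ((M.submatrix some some).updateRow v (Pi.single v 1)).permanent := by
  unfold permanent
  rw [← (Equiv.Perm.decomposeOption (α := n)).symm.sum_comp, Fintype.sum_prod_type,
    Fintype.sum_option]
  congr 1
  · rw [mul_sum]
    refine sum_congr rfl fun σ _ => ?_
    simp [Perm.decomposeOption]
  · rw [sum_eq_single v]
    · rw [mul_sum]
      refine sum_congr rfl fun σ _ => ?_
      rw [Fintype.prod_option]
      have h0 : M (Perm.decomposeOption.symm (some v, σ) none) none = b := by
        simp [Perm.decomposeOption, hc]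
      -- The index σ⁻¹ v is the one sent to `none`. Its factor is c if σ fixes v and 0 otherwise,
      -- which matches the row `Pi.single v 1` on the right.
      rw [h0, ← mul_prod_erase _ _ (mem_univ (σ⁻¹ v)), mul_assoc,
        ← mul_prod_erase _ _ (mem_univ (σ⁻¹ v)), ← mul_assoc c]
      congr 2
      · simp [Perm.decomposeOption, hr, Pi.single_apply]
      · refine prod_congr rfl fun x hx => ?_
        have hx' : σ x ≠ v := fun h => ne_of_mem_erase hx (by simp [← h])
        have : Perm.decomposeOption.symm (some v, σ) (some x) = some (σ x) := by
          simp [Perm.decomposeOption]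
          rw [swap_apply_of_ne_of_ne] <;> simp [hx']
        rw [this]
        simp [hx']
    · intro x _ hx
      refine sum_eq_zero fun σ _ => ?_
      rw [Fintype.prod_option]
      simp [Perm.decomposeOption, hc, hx]
    · simp

theorem permanent_nonneg {M : Matrix n n ℤ} (h : ∀ i j, 0 ≤ M i j) : 0 ≤ M.permanent :=
  sum_nonneg fun _ _ => prod_nonneg fun _ _ => h _ _

theorem prod_diag_le_permanent {M : Matrix n n ℤ} (h : ∀ i j, 0 ≤ M i j) :
    ∏ i, M i i ≤ M.permanent :=
  single_le_sum (f := fun σ : Perm n => ∏ i, M (σ i) i)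
    (fun _ _ => prod_nonneg fun _ _ => h _ _) (mem_univ 1)

theorem eq_of_swap_eq_swap {α : Type*} [DecidableEq α] {a b x y : α} (hab : a ≠ b)
    (h : Equiv.swap a b = Equiv.swap x y) :
    (a = x ∧ b = y) ∨ (a = y ∧ b = x) := by
  have hb : Equiv.swap x y a = b := by rw [← h]; simp
  by_cases h2 : a = x
  · left; subst h2; simpa [eq_comm] using hb
  · by_cases h3 : a = y
    · right; subst h3; simpa [eq_comm] using hb
    · rw [swap_apply_of_ne_of_ne h2 h3] at hb
      exact absurd hb hab

/-- The identity and the transpositions bound the permanent of a nonnegative matrix below. -/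
theorem two_mul_prod_diag_add_le_two_mul_permanent {M : Matrix n n ℤ} (h : ∀ i j, 0 ≤ M i j) :
    2 * ∏ i, M i i + ∑ p : n × n with p.1 ≠ p.2, ∏ i, M (Equiv.swap p.1 p.2 i) i ≤
      2 * M.permanent := by
  have hn : ∀ σ : Perm n, 0 ≤ ∏ i, M (σ i) i := fun σ => prod_nonneg fun _ _ => h _ _
  unfold permanent
  rw [← add_sum_erase univ _ (mem_univ (1 : Perm n)), mul_add, mul_sum]
  refine add_le_add (by simp) ?_
  rw [← sum_fiberwise_of_maps_to (t := univ.erase (1 : Perm n)) (g := fun p => Equiv.swap p.1 p.2)]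
  · refine sum_le_sum fun σ _ => ?_
    rw [sum_congr rfl (g := fun _ => ∏ i, M (σ i) i)
      (fun p hp => by rw [(mem_filter.1 hp).2]), sum_const, nsmul_eq_mul]
    refine mul_le_mul_of_nonneg_right ?_ (hn σ)
    norm_cast
    rcases eq_empty_or_nonempty
      ({p ∈ ({p : n × n | p.1 ≠ p.2} : Finset (n × n)) | Equiv.swap p.1 p.2 = σ}) with h0 | ⟨q, hq⟩
    · rw [h0]; simp
    -- A transposition comes from only two ordered pairs, whence the factor 2 in the statement.
    · refine (card_le_card (t := {q, q.swap}) fun p hp => ?_).trans card_le_two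
      simp only [mem_filter, mem_univ, true_and] at hp hq
      rcases eq_of_swap_eq_swap hp.1 (hp.2.trans hq.2.symm) with h1 | h1 <;>
        simp [Prod.ext_iff, h1]
  · intro p hp
    simpa [swap_eq_one_iff] using hp

end Matrix

/-! ### Absorbing several pendant indices into the diagonal. -/

namespace Matrix

/-- `B` bordered by a pendant index with diagonal entry `1` for every `l`, joined to `f l`. -/
def pendantBlocks {K Λ : Type*} [DecidableEq K] [DecidableEq Λ] (B : Matrix K K ℤ) (f : Λ → K) :
    Matrix (K ⊕ Λ) (K ⊕ Λ) ℤ :=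
  fromBlocks B (of fun i l => if i = f l then 1 else 0) (of fun l i => if i = f l then 1 else 0) 1

/-- Expanding along one pendant index gives the permanent of the rest plus its minor at the
attachment point, which amounts to adding 1 to that diagonal entry. Induction on Λ repeats this. -/
theorem permanent_pendantBlocks {K : Type*} [DecidableEq K] [Fintype K] (Λ : Type*) [Fintype Λ] :
    ∀ [DecidableEq Λ] (B : Matrix K K ℤ) (f : Λ → K),
      (pendantBlocks B f).permanent =
        (B + diagonal fun i => (#{l | f l = i} : ℤ)).permanent := by
  refine Fintype.induction_empty_option (P := fun Λ _ =>
    ∀ [DecidableEq Λ] (B : Matrix K K ℤ) (f : Λ → K),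
      (pendantBlocks B f).permanent =
        (B + diagonal fun i => (#{l | f l = i} : ℤ)).permanent) ?_ ?_ ?_ Λ
  · intro α β _ e ih _ B f
    let : Fintype α := Fintype.ofEquiv β e.symm
    classical
    have h := ih B (f ∘ e)
    rw [← permanent_submatrix_equiv ((Equiv.refl K).sumCongr e)]
    convert h using 2
    · ext (i | i) (j | j) <;> simp [pendantBlocks, Matrix.one_apply]
    · congr 2
      ext i
      congr 1
      exact (card_bij (fun l _ => e l) (by simp) (by simp)
        (fun b hb => ⟨e.symm b, by simpa using hb, by simp⟩)).symm
  · intro _ B f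
    rw [← permanent_submatrix_equiv (Equiv.sumEmpty K PEmpty)]
    congr 1
    ext (i | i) (j | j)
    · simp [pendantBlocks]
    all_goals first | exact i.elim | exact j.elim
  · intro Λ _ ih _ B f
    classical
    let e : Option (K ⊕ Λ) ≃ K ⊕ Option Λ :=
      { toFun := fun x => x.elim (.inr none) (Sum.map id some)
        invFun := Sum.elim (fun i => some (.inl i)) (fun l => l.elim none fun l => some (.inr l))
        left_inv := by rintro (_ | _ | _) <;> rfl
        right_inv := by rintro (_ | _ | _) <;> rfl }
    have hs : ((pendantBlocks B f).submatrix e e).submatrix some some =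
        pendantBlocks B (f ∘ some) := by
      ext (i | i) (j | j) <;> simp [pendantBlocks, e, Matrix.one_apply]
    have h1 : pendantBlocks B (f ∘ some) + Matrix.single (.inl (f none)) (.inl (f none)) 1 =
        pendantBlocks (B + Matrix.single (f none) (f none) 1) (f ∘ some) := by
      ext (i | i) (j | j) <;> simp [pendantBlocks, Matrix.single_apply]
    have h2 : (pendantBlocks B f).submatrix e e none none = 1 := by simp [pendantBlocks, e]
    rw [← permanent_submatrix_equiv e,
      permanent_option_of_pendant _ (.inl (f none)) 1 1, hs, h2, mul_one, one_mul,
      ← permanent_add_single, h1, ih, add_assoc]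
    · congr 2
      ext i j
      by_cases hij : i = j
      · subst hij
        simp only [Matrix.add_apply, Matrix.single_apply, diagonal_apply_eq, card_filter,
          Fintype.sum_option, Function.comp_apply, and_self]
        push_cast
        rfl
      · simp [hij, Matrix.single_apply]
        rintro rfl; exact hij
    · rintro (x | x) <;> simp [pendantBlocks, e]
    · rintro (x | x) <;> simp [pendantBlocks, e]

end Matrix

open scoped Classical

/-! ### The signless Laplacian and pendant vertices. -/

namespace SimpleGraph

variable {V W : Type*} [Fintype V] [Fintype W]

theorem degree_eq_sum_ite (G : SimpleGraph V) (x : V) :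
    G.degree x = ∑ y, if G.Adj x y then 1 else 0 := by
  rw [← card_neighborFinset_eq_degree, neighborFinset_eq_filter, card_filter]

/-- The signless Laplacian matrix `D(G) + A(G)`. -/
noncomputable def signlessLap (G : SimpleGraph V) : Matrix V V ℤ :=
  Matrix.of fun x y => if x = y then (G.degree x : ℤ) else if G.Adj x y then 1 else 0

theorem signlessLap_self (G : SimpleGraph V) (x : V) : G.signlessLap x x = G.degree x := by
  simp [signlessLap]

theorem signlessLap_of_ne (G : SimpleGraph V) {x y : V} (h : x ≠ y) :
    G.signlessLap x y = if G.Adj x y then 1 else 0 := by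
  simp [signlessLap, h]

theorem signlessLap_nonneg (G : SimpleGraph V) (x y : V) : 0 ≤ G.signlessLap x y := by
  unfold signlessLap
  simp only [Matrix.of_apply]
  split_ifs <;> simp

theorem permanent_signlessLap_nonneg (G : SimpleGraph V) : 0 ≤ G.signlessLap.permanent :=
  Matrix.permanent_nonneg G.signlessLap_nonneg

/-- Conjugating by the diagonal ±1 matrix of the bipartition turns D - A into D + A, and the signs
multiply to 1 along every permutation. -/
theorem lapPer_eq_permanent_signlessLap (G : SimpleGraph V) (hG : G.IsBipartite) :
    lapPer G = G.signlessLap.permanent := by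
  obtain ⟨k⟩ := hG
  let ε : V → ℤ := fun x => if k x = 0 then 1 else -1
  have hε : ∀ x, ε x * ε x = 1 := fun x => by simp only [ε]; split_ifs <;> rfl
  have hne : ∀ x y, G.Adj x y → ε x * ε y = -1 := fun x y h => by
    have := k.valid h
    simp only [ε]
    generalize k x = a at *
    generalize k y = b at *
    revert a b; decide
  have hL : ∀ x y, G.lapMatrix ℤ x y = ε x * ε y * G.signlessLap x y := by
    intro x y
    by_cases hxy : x = y
    · subst hxy
      simp [lapMatrix, degMatrix, signlessLap_self, hε]
    · rw [signlessLap_of_ne _ hxy]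
      by_cases h : G.Adj x y
      · simp [lapMatrix, degMatrix, hxy, h, hne]
      · simp [lapMatrix, degMatrix, hxy, h]
  have : lapPer G = (G.lapMatrix ℤ).permanent := by unfold lapPer; congr
  rw [this]
  refine sum_congr rfl fun σ _ => ?_
  simp_rw [hL, prod_mul_distrib]
  rw [Equiv.prod_comp σ ε, ← prod_mul_distrib]
  simp [hε]

theorem degree_iso {G : SimpleGraph V} {H : SimpleGraph W} (e : G ≃g H) (x : V) :
    H.degree (e x) = G.degree x := by
  rw [degree_eq_sum_ite, degree_eq_sum_ite]
  exact (Fintype.sum_equiv e.toEquiv _ _ fun y => by simp [← e.map_adj_iff]).symm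

theorem lapPer_iso {G : SimpleGraph V} {H : SimpleGraph W} (e : G ≃g H) :
    lapPer G = lapPer H := by
  have h1 : lapPer G = (G.lapMatrix ℤ).permanent := by unfold lapPer; congr
  have h2 : lapPer H = (H.lapMatrix ℤ).permanent := by unfold lapPer; congr
  rw [h1, h2, ← Matrix.permanent_submatrix_equiv e.toEquiv]
  congr 1
  ext x y
  have hd := degree_iso e x
  by_cases hxy : x = y
  · subst hxy
    simp [lapMatrix, degMatrix, hd]
  · simp [lapMatrix, degMatrix, hxy, ← e.map_adj_iff]

/-- `G` is obtained from `H` by adding the pendant vertex `e none` at `v`. -/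
structure IsPendantExtension (G : SimpleGraph V) (H : SimpleGraph W) (e : Option W ≃ V) (v : W) :
    Prop where
  adj_some : ∀ x y, G.Adj (e (some x)) (e (some y)) ↔ H.Adj x y
  adj_none : ∀ x, G.Adj (e none) (e (some x)) ↔ x = v

namespace IsPendantExtension

variable {V W : Type*} [Fintype V] {G : SimpleGraph V} {H : SimpleGraph W} {e : Option W ≃ V}
  {v : W}

theorem signlessLap_none_some (h : IsPendantExtension G H e v) (x : W) :
    G.signlessLap (e none) (e (some x)) = if x = v then 1 else 0 := by
  rw [signlessLap_of_ne _ (by simp)]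
  simp [h.adj_none]

theorem signlessLap_some_none (h : IsPendantExtension G H e v) (x : W) :
    G.signlessLap (e (some x)) (e none) = if x = v then 1 else 0 := by
  rw [signlessLap_of_ne _ (by simp)]
  simp [G.adj_comm _ (e none), h.adj_none]

variable [Fintype W]

theorem degree_some (h : IsPendantExtension G H e v) (x : W) :
    G.degree (e (some x)) = H.degree x + if x = v then 1 else 0 := by
  rw [degree_eq_sum_ite, degree_eq_sum_ite, ← e.sum_comp, Fintype.sum_option, add_comm]
  congr 1
  · simp [h.adj_some]
  · simp [G.adj_comm _ (e none), h.adj_none]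

theorem degree_none (h : IsPendantExtension G H e v) : G.degree (e none) = 1 := by
  rw [degree_eq_sum_ite, ← e.sum_comp, Fintype.sum_option]
  simp [h.adj_none]

theorem sum_degrees (h : IsPendantExtension G H e v) :
    ∑ x, G.degree x = ∑ x, H.degree x + 2 := by
  rw [← e.sum_comp, Fintype.sum_option, h.degree_none, sum_congr rfl fun x _ => h.degree_some x,
    sum_add_distrib]
  simp only [sum_ite_eq', mem_univ, if_true]
  ring

theorem submatrix_signlessLap (h : IsPendantExtension G H e v) :
    (G.signlessLap.submatrix e e).submatrix some some =
      H.signlessLap + Matrix.single v v 1 := by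
  ext x y
  by_cases hxy : x = y
  · subst hxy
    by_cases hx : x = v
    · subst hx
      simp [signlessLap_self, h.degree_some]
    · simp [signlessLap_self, h.degree_some, hx, Ne.symm hx]
  · have h1 : e (some x) ≠ e (some y) := by simpa using hxy
    have h2 : ¬ (v = x ∧ v = y) := by rintro ⟨rfl, rfl⟩; exact hxy rfl
    simp [signlessLap_of_ne _ h1, signlessLap_of_ne _ hxy, h.adj_some, h2]

/-- The minor at v enters twice: once because the degree of v rises by 1, once through the
transposition of v with the new vertex. -/
theorem permanent_signlessLap (h : IsPendantExtension G H e v) :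
    G.signlessLap.permanent =
      H.signlessLap.permanent + 2 * (H.signlessLap.updateRow v (Pi.single v 1)).permanent := by
  have h1 : G.signlessLap.submatrix e e none none = 1 := by
    simp [signlessLap_self, h.degree_none]
  rw [← Matrix.permanent_submatrix_equiv e,
    Matrix.permanent_option_of_pendant _ v 1 1 h.signlessLap_some_none h.signlessLap_none_some, h1,
    h.submatrix_signlessLap, Matrix.permanent_add_single]
  have : (H.signlessLap + Matrix.single v v 1).updateRow v (Pi.single v 1) =
      H.signlessLap.updateRow v (Pi.single v 1) := by
    ext x y
    by_cases hx : x = v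
    · subst hx; simp
    · simp [hx, Ne.symm hx]
  rw [this]
  ring

/-- Deleting the row and column of the pendant vertex leaves the raised diagonal entry at v, so the
minor enters only once. -/
theorem permanent_updateRow_signlessLap (h : IsPendantExtension G H e v) :
    (G.signlessLap.updateRow (e none) (Pi.single (e none) 1)).permanent =
      H.signlessLap.permanent + (H.signlessLap.updateRow v (Pi.single v 1)).permanent := by
  set M := G.signlessLap.updateRow (e none) (Pi.single (e none) 1) with hM
  have h1 : M.submatrix e e none none = 1 := by simp [hM]
  have h2 : (M.submatrix e e).submatrix some some = H.signlessLap + Matrix.single v v 1 := by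
    rw [← h.submatrix_signlessLap]
    ext x y
    simp [hM, Matrix.updateRow_apply]
  rw [← Matrix.permanent_submatrix_equiv e, Matrix.permanent_option_of_pendant _ v 1 0, h1, h2,
    Matrix.permanent_add_single]
  · ring
  · intro x
    simp [hM, Matrix.updateRow_apply, h.signlessLap_some_none]
  · intro x
    simp [hM]

end IsPendantExtension

theorem exists_isPendantExtension (G : SimpleGraph V) {w : V} (hw : G.degree w = 1) :
    ∃ v, IsPendantExtension G (G.comap (Subtype.val : {x // x ≠ w} → V))
      (Equiv.optionSubtypeNe w) v := by
  obtain ⟨v, hv, hu⟩ := degree_eq_one_iff_existsUnique_adj.mp hw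
  refine ⟨⟨v, hv.ne'⟩, ⟨fun x y => by simp, fun x => ?_⟩⟩
  simp only [optionSubtypeNe_none, optionSubtypeNe_some, Subtype.ext_iff]
  exact ⟨hu _, fun h => h ▸ hv⟩

/-- Attaching a pendant vertex to a pendant vertex at least doubles the permanent. -/
theorem IsPendantExtension.two_mul_permanent_le {G : SimpleGraph V} {H : SimpleGraph W}
    {e : Option W ≃ V} {v : W} (h : IsPendantExtension G H e v) (hv : H.degree v = 1) :
    2 * H.signlessLap.permanent ≤ G.signlessLap.permanent := by
  -- Let K be H without v. The two expansions at u show that twice the minor of H at v is per Q(H) +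
  -- per Q(K), which is at least per Q(H).
  obtain ⟨u, hu⟩ := H.exists_isPendantExtension hv
  have h1 := hu.permanent_updateRow_signlessLap
  rw [optionSubtypeNe_none] at h1
  have h2 := hu.permanent_signlessLap
  have h3 := permanent_signlessLap_nonneg (H.comap (Subtype.val : {x // x ≠ v} → W))
  rw [h.permanent_signlessLap, h1]
  linarith

/-- A connected bipartite graph with as many edges as vertices, counting edges by degrees. -/
structure BipartiteUnicyclic (G : SimpleGraph V) : Prop where
  connected : G.Connected
  bipartite : G.IsBipartite
  sum_degrees : ∑ x, G.degree x = 2 * Fintype.card V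

theorem _root_.isBipartiteUnicyclic_iff {n : ℕ} {G : SimpleGraph V} :
    IsBipartiteUnicyclic n G ↔ Fintype.card V = n ∧ G.BipartiteUnicyclic := by
  have he : ∑ x, G.degree x = 2 * Nat.card G.edgeSet := by
    rw [sum_degrees_eq_twice_card_edges, Nat.card_eq_fintype_card, edgeFinset_card]
  constructor
  · rintro ⟨h1, h2, h3, h4⟩
    rw [Nat.card_eq_fintype_card] at h1
    exact ⟨h1, h3, h4, by rw [he, h2, h1]⟩
  · rintro ⟨h1, h3, h4, h5⟩
    exact ⟨by rw [Nat.card_eq_fintype_card, h1], by omega, h3, h4⟩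

theorem BipartiteUnicyclic.comap {G : SimpleGraph V} (hG : G.BipartiteUnicyclic) {w : V}
    (hw : G.degree w = 1) :
    (G.comap (Subtype.val : {x // x ≠ w} → V)).BipartiteUnicyclic := by
  obtain ⟨v, hv⟩ := G.exists_isPendantExtension hw
  refine ⟨hG.connected.induce_compl_singleton_of_degree_eq_one hw,
    hG.bipartite.of_hom (SimpleGraph.Embedding.comap ⟨_, Subtype.val_injective⟩ G).toHom, ?_⟩
  have h1 := hG.sum_degrees
  rw [hv.sum_degrees, ← Fintype.card_congr (Equiv.optionSubtypeNe w), Fintype.card_option] at h1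
  omega

end SimpleGraph

/-- Expansion along column 0, used to evaluate a 4 × 4 permanent; the remaining rows are listed
through a swap, as the order of rows is immaterial. -/
theorem Matrix.permanent_succ {n : ℕ} (M : Matrix (Fin (n + 1)) (Fin (n + 1)) ℤ) :
    M.permanent = ∑ p, M p 0 *
      (Matrix.of fun i j : Fin n => M (Equiv.swap 0 p i.succ) j.succ).permanent := by
  unfold Matrix.permanent
  rw [← Equiv.Perm.decomposeFin.symm.sum_comp, Fintype.sum_prod_type]
  refine sum_congr rfl fun p _ => ?_
  rw [mul_sum]
  refine sum_congr rfl fun σ _ => ?_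
  simp [Fin.prod_univ_succ]

/-! ### The four-cycle with pendant vertices and its permanent. -/

namespace SimpleGraph

instance isEmpty_starVertex : IsEmpty ((i : Fin 4) × Fin ((![0, 0, 0, 0] : Fin 4 → ℕ) i)) :=
  ⟨fun ⟨i, a⟩ => by
    have h : (![0, 0, 0, 0] : Fin 4 → ℕ) i = 0 := by fin_cases i <;> rfl
    rw [h] at a
    exact a.elim0⟩

/-- The cycle of length four with `s i` pendant vertices at its `i`-th vertex. -/
abbrev hairyC4 (s : Fin 4 → ℕ) : SimpleGraph (C4Vertex s ![0, 0, 0, 0]) :=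
  C4Graph s ![0, 0, 0, 0]

section hairyC4

variable {s : Fin 4 → ℕ}

theorem hairyC4_adj_inl_inl {i j : Fin 4} :
    (hairyC4 s).Adj (.inl i) (.inl j) ↔ (cycleGraph 4).Adj i j := by
  simp only [hairyC4, C4Graph, fromRel_adj, C4Rel, (cycleGraph 4).adj_comm j i, or_self, ne_eq,
    Sum.inl.injEq, and_iff_right_iff_imp]
  exact Adj.ne

theorem hairyC4_adj_inl_inr {i : Fin 4} {l : (i : Fin 4) × Fin (s i)} :
    (hairyC4 s).Adj (.inl i) (.inr (.inl l)) ↔ i = l.1 := by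
  simp [hairyC4, C4Graph, fromRel_adj, C4Rel]

theorem hairyC4_adj_inr_inl {i : Fin 4} {l : (i : Fin 4) × Fin (s i)} :
    (hairyC4 s).Adj (.inr (.inl l)) (.inl i) ↔ i = l.1 := by
  rw [adj_comm, hairyC4_adj_inl_inr]

theorem not_hairyC4_adj_inr_inr {l m : (i : Fin 4) × Fin (s i)} :
    ¬ (hairyC4 s).Adj (.inr (.inl l)) (.inr (.inl m)) := by
  simp [hairyC4, C4Graph, fromRel_adj, C4Rel]

theorem degree_hairyC4_inl (i : Fin 4) : (hairyC4 s).degree (.inl i) = 2 + s i := by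
  rw [degree_eq_sum_ite, Fintype.sum_sum_type, Fintype.sum_sum_type]
  simp only [hairyC4_adj_inl_inl, hairyC4_adj_inl_inr, univ_eq_empty, sum_empty, add_zero,
    Fintype.sum_sigma]
  congr 1
  · have : (cycleGraph 4).degree i = 2 := by rw [cycleGraph_degree_three_le]
    rw [← this]
    convert (degree_eq_sum_ite (cycleGraph 4) i).symm
  · rw [sum_eq_single i] <;> simp +contextual [eq_comm]

theorem degree_hairyC4_inr (l : (i : Fin 4) × Fin (s i)) :
    (hairyC4 s).degree (.inr (.inl l)) = 1 := by
  rw [degree_eq_sum_ite, Fintype.sum_sum_type, Fintype.sum_sum_type]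
  simp [hairyC4_adj_inr_inl, not_hairyC4_adj_inr_inr]

theorem card_hairyC4 : Fintype.card (C4Vertex s ![0, 0, 0, 0]) = ∑ i, s i + 4 := by
  rw [Fintype.card_sum, Fintype.card_sum,
    Fintype.card_eq_zero (α := (i : Fin 4) × Fin (![0, 0, 0, 0] i)), Fintype.card_sigma]
  simp [add_comm]

theorem bipartiteUnicyclic_hairyC4 : (hairyC4 s).BipartiteUnicyclic where
  connected := by
    have h4 : (cycleGraph 4).Connected := cycleGraph_connected
    let f : cycleGraph 4 →g hairyC4 s := ⟨Sum.inl, fun h => hairyC4_adj_inl_inl.2 h⟩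
    rw [connected_iff_exists_forall_reachable]
    refine ⟨.inl 0, ?_⟩
    have h (i : Fin 4) : (hairyC4 s).Reachable (.inl 0) (.inl i) := (h4.preconnected 0 i).map f
    rintro (i | l | l)
    · exact h i
    · exact (h l.1).trans (hairyC4_adj_inl_inr.2 rfl).reachable
    · exact isEmptyElim l
  bipartite := by
    let k : Fin 4 → Fin 2 := ![0, 1, 0, 1]
    refine ⟨Coloring.mk (Sum.elim k (Sum.elim (fun l => k l.1 + 1) fun _ => 0)) ?_⟩
    have h1 : ∀ i j, (cycleGraph 4).Adj i j → k i ≠ k j := by decide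
    have h2 : ∀ a : Fin 2, a ≠ a + 1 := by decide
    rintro (i | l | l) (j | m | m) h
    · exact h1 i j (hairyC4_adj_inl_inl.1 h)
    · rw [hairyC4_adj_inl_inr] at h
      subst h; exact h2 _
    · exact isEmptyElim m
    · rw [hairyC4_adj_inr_inl] at h
      subst h; exact (h2 _).symm
    · exact absurd h not_hairyC4_adj_inr_inr
    · exact isEmptyElim m
    all_goals exact isEmptyElim l
  sum_degrees := by
    rw [Fintype.sum_sum_type, Fintype.sum_sum_type, card_hairyC4]
    simp only [degree_hairyC4_inl, degree_hairyC4_inr, univ_eq_empty, sum_empty, add_zero,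
      sum_add_distrib]
    simp
    ring

theorem isBipartiteUnicyclic_hairyC4 {n : ℕ} (h : n = ∑ i, s i + 4) :
    IsBipartiteUnicyclic n (hairyC4 s) :=
  isBipartiteUnicyclic_iff.2 ⟨by rw [h, card_hairyC4], bipartiteUnicyclic_hairyC4⟩

/-- Absorbing the hairs makes the diagonal entries 2 + 2 s i. The identity gives the first term and
the four edge transpositions the second; the two perfect matchings and the two 4-cycles give the
final 4. -/
theorem permanent_signlessLap_hairyC4 :
    (hairyC4 s).signlessLap.permanent =
      16 * ((1 + s 0) * (1 + s 1) * (1 + s 2) * (1 + s 3)) +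
        4 * ((2 + s 0 + s 2) * (2 + s 1 + s 3)) + 4 := by
  let B : Matrix (Fin 4) (Fin 4) ℤ :=
    !![2 + (s 0 : ℤ), 1, 0, 1; 1, 2 + (s 1 : ℤ), 1, 0; 0, 1, 2 + (s 2 : ℤ), 1;
      1, 0, 1, 2 + (s 3 : ℤ)]
  have hB : ∀ i j, B i j = if i = j then 2 + (s i : ℤ) else
      if (cycleGraph 4).Adj i j then 1 else 0 := by
    intro i j
    have : (cycleGraph 4).Adj i j ↔ j = i + 1 ∨ i = j + 1 := by revert i j; decide
    simp only [this]
    fin_cases i <;> fin_cases j <;> simp [B]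
  let f : ((i : Fin 4) × Fin (s i)) ⊕ ((i : Fin 4) × Fin ((![0, 0, 0, 0] : Fin 4 → ℕ) i)) → Fin 4 :=
    Sum.elim Sigma.fst Sigma.fst
  have h : (hairyC4 s).signlessLap = Matrix.pendantBlocks B f := by
    ext (i | l | l) (j | m | m)
    · by_cases hij : i = j
      · subst hij
        simp [signlessLap_self, degree_hairyC4_inl, Matrix.pendantBlocks, hB]
      · rw [signlessLap_of_ne _ (by simpa using hij)]
        simp [hairyC4_adj_inl_inl, Matrix.pendantBlocks, hB, hij]
    · rw [signlessLap_of_ne _ (by simp)]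
      simp only [hairyC4_adj_inl_inr, Matrix.pendantBlocks, f, Matrix.fromBlocks_apply₁₂,
        Matrix.of_apply, Sum.elim_inl]
      congr
    · exact isEmptyElim m
    · rw [signlessLap_of_ne _ (by simp)]
      simp only [hairyC4_adj_inr_inl, Matrix.pendantBlocks, f, Matrix.fromBlocks_apply₂₁,
        Matrix.of_apply, Sum.elim_inl]
      congr
    · by_cases hij : l = m
      · subst hij
        simp [signlessLap_self, degree_hairyC4_inr, Matrix.pendantBlocks]
      · rw [signlessLap_of_ne _ (by simpa using hij)]
        simp [not_hairyC4_adj_inr_inr, Matrix.pendantBlocks, hij]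
    · exact isEmptyElim m
    all_goals exact isEmptyElim l
  have hc : ∀ i, #{l | f l = i} = s i := by
    intro i
    rw [card_filter, Fintype.sum_sum_type]
    simp only [f, Fintype.sum_sigma, univ_eq_empty, sum_empty, add_zero, Sum.elim_inl]
    rw [sum_eq_single i] <;> simp +contextual
  rw [h, Matrix.permanent_pendantBlocks]
  simp only [hc]
  simp [Matrix.permanent_succ, Fin.sum_univ_succ, Equiv.swap_apply_def, B]
  ring

end hairyC4

end SimpleGraph

/-! ### At most four internal vertices force a four-cycle with hairs. -/

namespace SimpleGraph

variable {V : Type*}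

/-- `c` is a four-cycle of `G` and all other vertices are pendant vertices attached to it. -/
structure IsHairyCycle (G : SimpleGraph V) (c : Fin 4 → V) : Prop where
  injective : Function.Injective c
  adj_iff : ∀ i j, G.Adj (c i) (c j) ↔ (cycleGraph 4).Adj i j
  pendant : ∀ x, x ∉ Set.range c → ∃ i, ∀ y, G.Adj x y ↔ y = c i

theorem IsHairyCycle.comp {G : SimpleGraph V} {c : Fin 4 → V} (h : G.IsHairyCycle c)
    (σ : cycleGraph 4 ≃g cycleGraph 4) : G.IsHairyCycle (c ∘ σ) where
  injective := h.injective.comp σ.injective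
  adj_iff i j := (h.adj_iff _ _).trans σ.map_adj_iff
  pendant x hx := by
    obtain ⟨i, hi⟩ := h.pendant x (by simpa [Set.range_comp] using hx)
    exact ⟨σ.symm i, by simpa using hi⟩

variable [Fintype V]

/-- The number of pendant vertices attached at the `i`-th cycle vertex. -/
noncomputable def hairCount (G : SimpleGraph V) (c : Fin 4 → V) (i : Fin 4) : ℕ :=
  Fintype.card {x // x ∉ Set.range c ∧ G.Adj x (c i)}

theorem hairCount_comp (G : SimpleGraph V) (c : Fin 4 → V) (σ : cycleGraph 4 ≃g cycleGraph 4)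
    (i : Fin 4) : G.hairCount (c ∘ σ) i = G.hairCount c (σ i) := by
  have : Set.range (c ∘ σ) = Set.range c := by simp [Set.range_comp]
  unfold hairCount
  simp only [this, Function.comp_apply]

theorem IsHairyCycle.nonempty_iso {G : SimpleGraph V} {c : Fin 4 → V} (h : G.IsHairyCycle c)
    {s : Fin 4 → ℕ} (hs : ∀ i, G.hairCount c i = s i) : Nonempty (G ≃g hairyC4 s) := by
  have e (i : Fin 4) : Fin (s i) ≃ {x // x ∉ Set.range c ∧ G.Adj x (c i)} :=
    (Fintype.equivFinOfCardEq (hs i)).symm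
  let F : C4Vertex s ![0, 0, 0, 0] → V :=
    Sum.elim c (Sum.elim (fun l => (e l.1 l.2).1) isEmptyElim)
  have hr (l : (i : Fin 4) × Fin (s i)) : (e l.1 l.2).1 ∉ Set.range c := (e l.1 l.2).2.1
  have ha (l : (i : Fin 4) × Fin (s i)) (y : V) : G.Adj (e l.1 l.2).1 y ↔ y = c l.1 := by
    obtain ⟨i, hi⟩ := h.pendant _ (hr l)
    have := (hi _).1 (e l.1 l.2).2.2
    rw [hi, this]
  have hF : Function.Bijective F := by
    constructor
    · rintro (i | l | l) (j | m | m) hlm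
      · exact congrArg _ (h.injective hlm)
      · exact absurd ⟨i, hlm⟩ (hr m)
      · exact isEmptyElim m
      · exact absurd ⟨j, hlm.symm⟩ (hr l)
      · have hlm : (e l.1 l.2).1 = (e m.1 m.2).1 := hlm
        have h1 : l.1 = m.1 := by
          have := (ha l _).1 (by rw [hlm]; exact (ha m _).2 rfl)
          exact (h.injective this).symm
        obtain ⟨i, a⟩ := l
        obtain ⟨j, b⟩ := m
        obtain rfl : i = j := h1
        have : a = b := (e i).injective (Subtype.ext hlm)
        rw [this]
      · exact isEmptyElim m
      all_goals exact isEmptyElim l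
    · intro x
      by_cases hx : x ∈ Set.range c
      · obtain ⟨i, rfl⟩ := hx
        exact ⟨.inl i, rfl⟩
      · obtain ⟨i, hi⟩ := h.pendant x hx
        refine ⟨.inr (.inl ⟨i, (e i).symm ⟨x, hx, (hi _).2 rfl⟩⟩), ?_⟩
        simp [F]
  refine ⟨RelIso.symm ⟨Equiv.ofBijective F hF, ?_⟩⟩
  rintro (i | l | l) (j | m | m)
  · exact (h.adj_iff i j).trans hairyC4_adj_inl_inl.symm
  · rw [hairyC4_adj_inl_inr]
    exact (G.adj_comm _ _).trans ((ha m _).trans h.injective.eq_iff)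
  · exact isEmptyElim m
  · rw [hairyC4_adj_inr_inl]
    exact (ha l _).trans h.injective.eq_iff
  · refine iff_of_false (fun h1 => hr m ⟨l.1, ((ha l _).1 h1).symm⟩) not_hairyC4_adj_inr_inr
  · exact isEmptyElim m
  all_goals exact isEmptyElim l

/-- The vertices of degree at least two. -/
noncomputable def internalVertices (G : SimpleGraph V) : Finset V := {x | 2 ≤ G.degree x}

theorem mem_internalVertices {G : SimpleGraph V} {x : V} :
    x ∈ G.internalVertices ↔ 2 ≤ G.degree x := by simp [internalVertices]

namespace BipartiteUnicyclic

variable {G : SimpleGraph V} (hG : G.BipartiteUnicyclic)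
include hG

theorem degree_pos (x : V) (h : 2 ≤ Fintype.card V) : 1 ≤ G.degree x := by
  have : Nontrivial V := Fintype.one_lt_card_iff_nontrivial.1 h
  exact hG.connected.preconnected.degree_pos_of_nontrivial x

theorem degree_eq_one (x : V) (h : 2 ≤ Fintype.card V) (hx : x ∉ G.internalVertices) :
    G.degree x = 1 := by
  have := hG.degree_pos x h
  rw [mem_internalVertices] at hx
  omega

/-- Two adjacent vertices of degree 1 would form a whole component, so no walk could reach a third
vertex. -/
theorem not_adj_of_notMem (h : 3 ≤ Fintype.card V) {x y : V} (hx : x ∉ G.internalVertices)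
    (hy : y ∉ G.internalVertices) : ¬ G.Adj x y := by
  intro hxy
  have hx1 := hG.degree_eq_one x (by omega) hx
  have hy1 := hG.degree_eq_one y (by omega) hy
  have hcard : #({x, y} : Finset V) < Fintype.card V := (card_le_two).trans_lt h
  obtain ⟨z, hz⟩ : ∃ z, z ∉ ({x, y} : Finset V) := by
    by_contra! hz
    rw [eq_univ_of_forall hz, card_univ] at hcard
    omega
  obtain ⟨p⟩ := hG.connected.preconnected x z
  obtain ⟨d, -, h1, h2⟩ := p.exists_boundary_dart ({x, y} : Finset V) (by simp) (by simpa using hz)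
  have hd := d.adj
  simp only [coe_insert, coe_singleton, Set.mem_insert_iff, Set.mem_singleton_iff, not_or] at h1 h2
  obtain ⟨_, _, hu⟩ := degree_eq_one_iff_existsUnique_adj.mp hx1
  obtain ⟨_, _, hv⟩ := degree_eq_one_iff_existsUnique_adj.mp hy1
  rcases h1 with h1 | h1 <;> rw [h1] at hd
  · exact h2.2 ((hu _ hd).trans (hu _ hxy).symm)
  · exact h2.1 ((hv _ hd).trans (hv _ hxy.symm).symm)

/-- Each pendant vertex accounts for exactly one edge, which ends at an internal vertex. Removing
all of them therefore preserves the equality of vertex and edge counts. -/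
theorem sum_internal_adj (h : 3 ≤ Fintype.card V) :
    ∑ x ∈ G.internalVertices, ∑ y ∈ G.internalVertices, (if G.Adj x y then 1 else 0) =
      2 * #G.internalVertices := by
  set I := G.internalVertices with hI
  have h1 := hG.sum_degrees
  have h2 : ∑ x ∈ Iᶜ, G.degree x = #Iᶜ := by
    rw [card_eq_sum_ones]
    exact sum_congr rfl fun x hx => hG.degree_eq_one x (by omega) (mem_compl.1 hx)
  have h3 : ∑ x ∈ I, ∑ y ∈ Iᶜ, (if G.Adj x y then 1 else 0) = #Iᶜ := by
    rw [← h2, sum_comm]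
    refine sum_congr rfl fun y hy => ?_
    rw [degree_eq_sum_ite, ← sum_add_sum_compl I, eq_comm]
    simp only [G.adj_comm y]
    rw [add_eq_left]
    refine sum_eq_zero fun x hx => if_neg ?_
    exact hG.not_adj_of_notMem h (mem_compl.1 hx) (mem_compl.1 hy)
  have h4 : ∑ x ∈ I, G.degree x = ∑ x ∈ I, ∑ y ∈ I, (if G.Adj x y then 1 else 0) + #Iᶜ := by
    rw [← h3, ← sum_add_distrib]
    refine sum_congr rfl fun x _ => ?_
    rw [degree_eq_sum_ite, sum_add_sum_compl]
  rw [← sum_add_sum_compl I, h2, h4] at h1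
  have h5 := card_add_card_compl I
  omega

/-- If the internal vertices split into colour classes of sizes a and b, they span a + b edges, so a
+ b ≤ ab. With 0 < a + b ≤ 4 this forces a = b = 2 and all four cross edges, a four-cycle. -/
theorem exists_isHairyCycle (h : 4 ≤ Fintype.card V) (hI : #G.internalVertices ≤ 4) :
    ∃ c, G.IsHairyCycle c := by
  obtain ⟨k⟩ := hG.bipartite
  set I := G.internalVertices with hIdef
  have hsum := hG.sum_internal_adj (by omega)
  rw [← hIdef] at hsum
  set A : Finset V := {x ∈ I | k x = 0} with hA
  set B : Finset V := {x ∈ I | k x ≠ 0} with hB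
  have hAB : #A + #B = #I := card_filter_add_card_filter_not _
  have hcol : ∀ x y, G.Adj x y → (k x = 0 ↔ k y ≠ 0) := fun x y hxy => by
    have := k.valid hxy
    generalize k x = a at *
    generalize k y = b at *
    revert a b; decide
  set T : Finset (V × V) := {p ∈ A ×ˢ B | G.Adj p.1 p.2} with hT
  have hTc : #T = ∑ x ∈ A, ∑ y ∈ B, (if G.Adj x y then 1 else 0) := by
    rw [hT, card_filter, sum_product]
  have h2T : 2 * #T = 2 * #I := by
    rw [← hsum, ← sum_filter_add_sum_filter_not I (fun x => k x = 0), ← hA, ← hB, two_mul]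
    congr 1
    · rw [hTc]
      refine sum_congr rfl fun x hx => ?_
      rw [← sum_filter_add_sum_filter_not I (fun x => k x = 0), ← hA, ← hB, eq_comm, add_eq_right]
      refine sum_eq_zero fun y hy => if_neg fun hxy => ?_
      exact (hcol x y hxy).1 (mem_filter.1 hx).2 (mem_filter.1 hy).2
    · rw [hTc, sum_comm]
      refine sum_congr rfl fun x hx => ?_
      rw [← sum_filter_add_sum_filter_not I (fun x => k x = 0), ← hA, ← hB]
      simp only [G.adj_comm x]
      rw [eq_comm, add_eq_left]
      refine sum_eq_zero fun y hy => if_neg fun hxy => ?_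
      exact (mem_filter.1 hy).2 ((hcol y x hxy).2 (mem_filter.1 hx).2)
  have hTle : #T ≤ #A * #B := by
    rw [← card_product]
    exact card_filter_le _ _
  have hpos : 0 < #I := by
    by_contra h0
    have h0 : I = ∅ := by simpa using h0
    have h1 := hG.sum_degrees
    rw [sum_congr rfl fun x _ => hG.degree_eq_one x (by omega) (by rw [← hIdef, h0]; simp)] at h1
    simp at h1
    omega
  have h22 : #A = 2 ∧ #B = 2 := by
    have h1 : #A + #B ≤ 4 := by omega
    have h2 : #A + #B ≤ #A * #B := by omega
    have h3 : 0 < #A + #B := by omega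
    generalize #A = a at *
    generalize #B = b at *
    have : a ≤ 4 := by omega
    have : b ≤ 4 := by omega
    interval_cases a <;> interval_cases b <;> omega
  have hall : ∀ x ∈ A, ∀ y ∈ B, G.Adj x y := by
    have : #T = #(A ×ˢ B) := by rw [card_product, h22.1, h22.2]; omega
    rw [hT, card_filter_eq_iff] at this
    exact fun x hx y hy => this (x, y) (mem_product.2 ⟨hx, hy⟩)
  obtain ⟨p, q, hpq, hApq⟩ := card_eq_two.1 h22.1
  obtain ⟨r, t, hrt, hBrt⟩ := card_eq_two.1 h22.2
  have hmem : ∀ x, x ∈ I ↔ x = p ∨ x = r ∨ x = q ∨ x = t := by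
    intro x
    have : x ∈ I ↔ x ∈ A ∨ x ∈ B := by simp only [hA, hB, mem_filter]; tauto
    rw [this, hApq, hBrt]
    simp only [mem_insert, mem_singleton]
    tauto
  have hkA : ∀ x ∈ A, ∀ y ∈ A, ¬ G.Adj x y := fun x hx y hy hxy =>
    (hcol x y hxy).1 (mem_filter.1 hx).2 (mem_filter.1 hy).2
  have hkB : ∀ x ∈ B, ∀ y ∈ B, ¬ G.Adj x y := fun x hx y hy hxy =>
    (mem_filter.1 hx).2 ((hcol x y hxy).2 (mem_filter.1 hy).2)
  simp only [hApq, hBrt, mem_insert, mem_singleton, forall_eq_or_imp, forall_eq] at hall hkA hkB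
  obtain ⟨⟨hpr, hpt⟩, hqr, hqt⟩ := hall
  refine ⟨![p, r, q, t], ?_, ?_, ?_⟩
  · intro i j hij
    fin_cases i <;> fin_cases j <;>
      simp [hpq, hrt, Ne.symm hpq, Ne.symm hrt, hpr.ne, hpt.ne, hqr.ne, hqt.ne, hpr.ne', hpt.ne',
        hqr.ne', hqt.ne'] at hij ⊢
  · intro i j
    have : (cycleGraph 4).Adj i j ↔ j = i + 1 ∨ i = j + 1 := by revert i j; decide
    rw [this]
    fin_cases i <;> fin_cases j <;>
      simp [hpr, hpt, hqr, hqt, hpr.symm, hpt.symm, hqr.symm, hqt.symm, hkA, hkB]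
  · intro x hx
    have hxI : x ∉ I := by
      rw [hmem]
      rintro (rfl | rfl | rfl | rfl)
      exacts [hx ⟨0, rfl⟩, hx ⟨1, rfl⟩, hx ⟨2, rfl⟩, hx ⟨3, rfl⟩]
    obtain ⟨y, hy, hu⟩ := degree_eq_one_iff_existsUnique_adj.mp
      (hG.degree_eq_one x (by omega) hxI)
    have hyI : y ∈ I := by
      by_contra hyI
      exact hG.not_adj_of_notMem (by omega) hxI hyI hy
    obtain ⟨i, hi⟩ : ∃ i, y = ![p, r, q, t] i := by
      rcases (hmem y).1 hyI with h | h | h | h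
      exacts [⟨0, h⟩, ⟨1, h⟩, ⟨2, h⟩, ⟨3, h⟩]
    exact ⟨i, fun z => ⟨fun hz => by rw [← hi]; exact hu z hz, fun hz => by rw [hz, ← hi]; exact hy⟩⟩

end BipartiteUnicyclic

end SimpleGraph

/-! ### Lower bounds when there are at least five internal vertices. -/

theorem Matrix.prod_swap_mul_diag {n : Type*} [Fintype n] (M : Matrix n n ℤ) {x y : n}
    (h : x ≠ y) :
    (∏ i, M (Equiv.swap x y i) i) * (M x x * M y y) = M x y * M y x * ∏ i, M i i := by
  have hy : y ∈ univ.erase x := mem_erase.2 ⟨h.symm, mem_univ _⟩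
  rw [← mul_prod_erase univ _ (mem_univ x), ← mul_prod_erase univ (fun i => M i i) (mem_univ x),
    ← mul_prod_erase _ _ hy, ← mul_prod_erase _ (fun i => M i i) hy, swap_apply_left,
    swap_apply_right]
  have : ∏ i ∈ (univ.erase x).erase y, M (Equiv.swap x y i) i =
      ∏ i ∈ (univ.erase x).erase y, M i i := by
    refine prod_congr rfl fun i hi => ?_
    simp only [mem_erase] at hi
    rw [swap_apply_of_ne_of_ne hi.2.1 hi.1]
  rw [this]
  ring

namespace SimpleGraph

theorem lapPer_hairyC4 (s : Fin 4 → ℕ) :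
    lapPer (hairyC4 s) = 16 * ((1 + s 0) * (1 + s 1) * (1 + s 2) * (1 + s 3)) +
        4 * ((2 + s 0 + s 2) * (2 + s 1 + s 3)) + 4 := by
  rw [lapPer_eq_permanent_signlessLap _ bipartiteUnicyclic_hairyC4.bipartite]
  convert permanent_signlessLap_hairyC4

variable {V : Type*} [Fintype V] {G : SimpleGraph V}

theorem IsHairyCycle.card_eq {c : Fin 4 → V} (h : G.IsHairyCycle c) :
    Fintype.card V = ∑ i, G.hairCount c i + 4 := by
  obtain ⟨e⟩ := h.nonempty_iso fun _ => rfl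
  rw [← card_hairyC4, Fintype.card_congr e.toEquiv]

theorem IsHairyCycle.lapPer_eq {c : Fin 4 → V} (h : G.IsHairyCycle c) :
    lapPer G = lapPer (hairyC4 (G.hairCount c)) := by
  obtain ⟨e⟩ := h.nonempty_iso fun _ => rfl
  exact lapPer_iso e

theorem lapPer_hairyC4_ge (s : Fin 4 → ℕ) :
    24 * ((∑ i, s i + 4 : ℕ) : ℤ) - 60 ≤ lapPer (hairyC4 s) := by
  rw [lapPer_hairyC4]
  push_cast [Fin.sum_univ_four]
  -- The constant and linear parts of the formula are exactly 24n - 60; these are the remaining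
  -- terms.
  have : (0 : ℤ) ≤ 16 * (s 0 * s 1 + s 0 * s 2 + s 0 * s 3 + s 1 * s 2 + s 1 * s 3 + s 2 * s 3 +
    s 0 * s 1 * s 2 + s 0 * s 1 * s 3 + s 0 * s 2 * s 3 + s 1 * s 2 * s 3 +
    s 0 * s 1 * s 2 * s 3) + 4 * ((s 0 + s 2) * (s 1 + s 3)) := by positivity
  linarith

theorem BipartiteUnicyclic.lapPer_ge_of_card_internal_le (hG : G.BipartiteUnicyclic)
    (h : 4 ≤ Fintype.card V) (hI : #G.internalVertices ≤ 4) :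
    24 * (Fintype.card V : ℤ) - 60 ≤ lapPer G := by
  obtain ⟨c, hc⟩ := hG.exists_isHairyCycle h hI
  rw [hc.card_eq, hc.lapPer_eq]
  exact lapPer_hairyC4_ge _

theorem sum_pairs_adj_off (G : SimpleGraph V) (v : V) :
    #{p : V × V | G.Adj p.1 p.2 ∧ p.1 ≠ v ∧ p.2 ≠ v} + 2 * G.degree v = ∑ x, G.degree x := by
  have h1 : ∑ x, G.degree x = ∑ x ∈ univ.erase v, G.degree x + G.degree v :=
    (sum_erase_add _ _ (mem_univ v)).symm
  have h2 : ∑ x ∈ univ.erase v, G.degree x =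
      ∑ x ∈ univ.erase v, ∑ y ∈ univ.erase v, (if G.Adj x y then 1 else 0) +
        ∑ x ∈ univ.erase v, (if G.Adj v x then 1 else 0) := by
    rw [← sum_add_distrib]
    refine sum_congr rfl fun x _ => ?_
    rw [degree_eq_sum_ite, ← sum_erase_add _ _ (mem_univ v), G.adj_comm x v]
  have h3 : ∑ x ∈ univ.erase v, (if G.Adj v x then 1 else 0) = G.degree v := by
    rw [degree_eq_sum_ite, ← sum_erase_add _ _ (mem_univ v)]
    simp
  have h4 : #{p : V × V | G.Adj p.1 p.2 ∧ p.1 ≠ v ∧ p.2 ≠ v} =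
      ∑ x ∈ univ.erase v, ∑ y ∈ univ.erase v, (if G.Adj x y then 1 else 0) := by
    rw [← sum_product' (univ.erase v) (univ.erase v) fun x y => if G.Adj x y then 1 else 0,
      ← card_filter]
    congr 1
    ext p
    simp
    tauto
  omega

theorem sum_pairs_adj (G : SimpleGraph V) :
    #{p : V × V | G.Adj p.1 p.2} = ∑ x, G.degree x := by
  rw [card_filter, Fintype.sum_prod_type]
  exact sum_congr rfl fun x _ => (degree_eq_sum_ite G x).symm

/-- Deleting a non-pendant vertex leaves a large permanent if there are at least five
non-pendant vertices. -/
theorem BipartiteUnicyclic.permanent_updateRow_ge (hG : G.BipartiteUnicyclic)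
    (hI : 5 ≤ #G.internalVertices) {v : V} (hv : 2 ≤ G.degree v) :
    22 ≤ (G.signlessLap.updateRow v (Pi.single v 1)).permanent := by
  set M := G.signlessLap.updateRow v (Pi.single v 1) with hM
  have hcard : 5 ≤ Fintype.card V := hI.trans (card_le_univ _)
  have hM0 : ∀ i j, 0 ≤ M i j := by
    intro i j
    rw [hM, Matrix.updateRow_apply]
    split_ifs
    · by_cases hj : j = v
      · subst hj; simp
      · simp [hj]
    · exact G.signlessLap_nonneg i j
  have hMd : ∀ x, x ≠ v → M x x = G.degree x := fun x hx => by
    simp [hM, hx, signlessLap_self]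
  set J := G.internalVertices.erase v with hJ
  have hJc : #J + 1 = #G.internalVertices := card_erase_add_one (mem_internalVertices.2 hv)
  have hJ2 : ∀ x ∈ J, 2 ≤ G.degree x := fun x hx => mem_internalVertices.1 (mem_of_mem_erase hx)
  have hJ1 : ∀ x, x ≠ v → x ∉ J → G.degree x = 1 := fun x hx hxJ =>
    hG.degree_eq_one x (by omega) fun h => hxJ (mem_erase.2 ⟨hx, h⟩)
  have hvJ : v ∉ J := notMem_erase _ _
  have hprod : ∏ i, M i i = ((∏ x ∈ J, G.degree x : ℕ) : ℤ) := by
    push_cast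
    rw [← prod_subset (subset_univ J)]
    · exact prod_congr rfl fun x hx => hMd x (ne_of_mem_erase hx)
    · intro x _ hx
      by_cases hxv : x = v
      · subst hxv; simp [hM]
      · rw [hMd x hxv, hJ1 x hxv hx]; rfl
  have hpow : ∀ K ⊆ J, 2 ^ #K ≤ ∏ x ∈ K, G.degree x := fun K hK => by
    rw [← prod_const]
    exact prod_le_prod' fun x hx => hJ2 x (hK hx)
  -- The diagonal product suffices if J has five elements (2^5) or contains a vertex of degree at
  -- least 3 (3·2^3). Otherwise J consists of four vertices of degree 2, with product 16.
  by_cases hbig : 22 ≤ ∏ x ∈ J, G.degree x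
  · refine le_trans ?_ (Matrix.prod_diag_le_permanent hM0)
    rw [hprod]
    exact_mod_cast hbig
  have hJ4 : #J = 4 := by
    by_contra hne
    refine hbig (le_trans ?_ (hpow J subset_rfl))
    calc 22 ≤ 2 ^ 5 := by norm_num
      _ ≤ 2 ^ #J := Nat.pow_le_pow_right (by norm_num) (by omega)
  have hJeq : ∀ x ∈ J, G.degree x = 2 := by
    intro x hx
    by_contra hne
    refine hbig ?_
    have h3 : 3 ≤ G.degree x := by have := hJ2 x hx; omega
    have h4 : 2 ^ 3 ≤ ∏ y ∈ J.erase x, G.degree y := by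
      have := hpow (J.erase x) (erase_subset _ _)
      rwa [card_erase_of_mem hx, hJ4] at this
    rw [← mul_prod_erase J _ hx]
    calc 22 ≤ 3 * 2 ^ 3 := by norm_num
      _ ≤ _ := Nat.mul_le_mul h3 h4
  have hprod16 : ∏ i, M i i = 16 := by
    rw [hprod, prod_congr rfl hJeq, prod_const, hJ4]; norm_num
  have hle2 : ∀ x, x ≠ v → 1 ≤ G.degree x ∧ G.degree x ≤ 2 := fun x hx => by
    by_cases hxJ : x ∈ J
    · simp [hJeq x hxJ]
    · simp [hJ1 x hx hxJ]
  have hdeg : ∑ x, G.degree x = 3 + Fintype.card V + G.degree v := by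
    rw [← sum_erase_add _ _ (mem_univ v), ← sum_sdiff (erase_subset_erase v
      (subset_univ G.internalVertices)), ← hJ, sum_congr rfl hJeq, sum_congr (g := fun _ => 1) rfl]
    · rw [sum_const, sum_const, card_sdiff_of_subset (erase_subset_erase v (subset_univ _)),
        card_erase_of_mem (mem_univ v), ← hJ, hJ4, card_univ]
      simp only [smul_eq_mul]
      omega
    · intro x hx
      simp only [mem_sdiff, mem_erase, mem_univ, and_true] at hx
      exact hJ1 x hx.1 hx.2
  set P : Finset (V × V) := {p : V × V | G.Adj p.1 p.2 ∧ p.1 ≠ v ∧ p.2 ≠ v} with hP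
  -- Here n = 3 + deg v, so exactly three edges avoid v, giving six ordered pairs. Each
  -- transposition contributes 16/(deg x · deg y) ≥ 4, so the minor is at least 16 + 3·4 = 28.
  have hPc : #P = 6 := by
    have h1 : #P + 2 * G.degree v = ∑ x, G.degree x := G.sum_pairs_adj_off v
    have h2 := hG.sum_degrees
    omega
  have hterm : ∀ p ∈ P, 4 ≤ ∏ i, M (Equiv.swap p.1 p.2 i) i := by
    rintro ⟨x, y⟩ hp
    simp only [hP, mem_filter, mem_univ, true_and] at hp
    obtain ⟨hxy, hx, hy⟩ := hp
    have h1 := Matrix.prod_swap_mul_diag M hxy.ne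
    have hMxy : M x y = 1 := by simp [hM, hx, signlessLap_of_ne _ hxy.ne, hxy]
    have hMyx : M y x = 1 := by simp [hM, hy, signlessLap_of_ne _ hxy.ne', hxy.symm]
    rw [hMd x hx, hMd y hy, hMxy, hMyx, hprod16] at h1
    have h3 : (0 : ℤ) ≤ ∏ i, M (Equiv.swap x y i) i := prod_nonneg fun _ _ => hM0 _ _
    obtain ⟨hx1, hx2⟩ := hle2 x hx
    obtain ⟨hy1, hy2⟩ := hle2 y hy
    have h4 : (G.degree x : ℤ) * G.degree y ≤ 4 := by
      exact_mod_cast Nat.mul_le_mul hx2 hy2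
    show 4 ≤ ∏ i, M (Equiv.swap x y i) i
    nlinarith
  have hmain := Matrix.two_mul_prod_diag_add_le_two_mul_permanent hM0
  have hsum : (24 : ℤ) ≤ ∑ p : V × V with p.1 ≠ p.2, ∏ i, M (Equiv.swap p.1 p.2 i) i := by
    calc (24 : ℤ) = ∑ p ∈ P, 4 := by rw [sum_const, hPc]; norm_num
      _ ≤ ∑ p ∈ P, ∏ i, M (Equiv.swap p.1 p.2 i) i := sum_le_sum hterm
      _ ≤ _ := by
        refine sum_le_sum_of_subset_of_nonneg ?_ fun _ _ _ => prod_nonneg fun _ _ => hM0 _ _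
        intro p hp
        simp only [hP, mem_filter, mem_univ, true_and] at hp ⊢
        exact hp.1.ne
  rw [hprod16] at hmain
  linarith

/-- The identity contributes 2^n and each of the n edge transpositions 2^(n-2); the factor 4 clears
the denominator. -/
theorem permanent_signlessLap_ge_of_two_regular (h : ∀ x, G.degree x = 2) :
    (4 + Fintype.card V) * 2 ^ Fintype.card V ≤ 4 * G.signlessLap.permanent := by
  have hdiag : ∏ i, G.signlessLap i i = 2 ^ Fintype.card V := by
    simp [signlessLap_self, h]
  have hmain := Matrix.two_mul_prod_diag_add_le_two_mul_permanent G.signlessLap_nonneg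
  have hsum : (2 * Fintype.card V : ℤ) * 2 ^ Fintype.card V ≤
      4 * ∑ p : V × V with p.1 ≠ p.2, ∏ i, G.signlessLap (Equiv.swap p.1 p.2 i) i := by
    have hP : (#{p : V × V | G.Adj p.1 p.2} : ℤ) = 2 * Fintype.card V := by
      rw [sum_pairs_adj, sum_congr rfl fun x _ => h x]
      simp [mul_comm]
    set T : V × V → ℤ := fun p => ∏ i, G.signlessLap (Equiv.swap p.1 p.2 i) i with hT
    have hT0 : ∀ p, 0 ≤ T p := fun p => prod_nonneg fun _ _ => G.signlessLap_nonneg _ _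
    have hTP : ∀ p ∈ ({p : V × V | G.Adj p.1 p.2} : Finset (V × V)),
        (2 : ℤ) ^ Fintype.card V ≤ 4 * T p := by
      rintro ⟨x, y⟩ hp
      replace hp : G.Adj x y := by simpa using hp
      have h1 := Matrix.prod_swap_mul_diag G.signlessLap hp.ne
      rw [hdiag, signlessLap_self, signlessLap_self, h, h, signlessLap_of_ne _ hp.ne,
        signlessLap_of_ne _ hp.ne', if_pos hp, if_pos hp.symm] at h1
      have h2 : T (x, y) * (((2 : ℕ) : ℤ) * ((2 : ℕ) : ℤ)) = 1 * 1 * 2 ^ Fintype.card V := h1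
      push_cast at h2
      linarith
    have h1 := card_nsmul_le_sum _ (fun p => 4 * T p) _ hTP
    rw [nsmul_eq_mul, hP, ← mul_sum] at h1
    refine h1.trans (mul_le_mul_of_nonneg_left ?_ (by norm_num))
    refine sum_le_sum_of_subset_of_nonneg (fun p hp => ?_) fun _ _ _ => hT0 _
    simp only [mem_filter, mem_univ, true_and] at hp ⊢
    exact hp.ne
  rw [hdiag] at hmain
  linarith

/-- A new pendant vertex creates a new internal vertex only when it is attached to a pendant one. In
the second alternative the lower bound on internal vertices passes from G to H. -/
theorem IsPendantExtension.internal_dichotomy {W : Type*} [Fintype W] {H : SimpleGraph W}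
    {e : Option W ≃ V} {v : W} (h : IsPendantExtension G H e v) (hH : H.BipartiteUnicyclic)
    (hW : 2 ≤ Fintype.card W) :
    H.degree v = 1 ∨ 2 ≤ H.degree v ∧ #G.internalVertices ≤ #H.internalVertices := by
  rcases (hH.degree_pos v hW).eq_or_lt with h1 | h1
  · exact .inl h1.symm
  · refine .inr ⟨h1, (card_le_card (t := H.internalVertices.map
      (Function.Embedding.some.trans e.toEmbedding)) fun x hx => ?_).trans (card_map _).le⟩
    obtain ⟨x, rfl⟩ := e.surjective x
    rw [mem_internalVertices] at hx
    cases x with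
    | none => rw [h.degree_none] at hx; omega
    | some x =>
      refine mem_map.2 ⟨x, ?_, rfl⟩
      rw [mem_internalVertices]
      rw [h.degree_some] at hx
      split_ifs at hx with hxv
      · subst hxv; exact h1
      · exact hx

theorem IsPendantExtension.lt_permanent {W : Type*} [Fintype W] {H : SimpleGraph W}
    {e : Option W ≃ V} {v : W} (h : IsPendantExtension G H e v) (hH : H.BipartiteUnicyclic)
    {n : ℕ} (hn : Fintype.card W = n) (h4 : 4 ≤ n) (hI : 5 ≤ #G.internalVertices)
    (ih : 5 ≤ #H.internalVertices → 44 * (n : ℤ) - 160 < H.signlessLap.permanent) :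
    44 * ((n + 1 : ℕ) : ℤ) - 160 < G.signlessLap.permanent := by
  push_cast
  have h4' : (4 : ℤ) ≤ n := by exact_mod_cast h4
  rcases h.internal_dichotomy hH (by omega) with h1 | h1
  · have h2 := h.two_mul_permanent_le h1
    -- Here H may have only four internal vertices, so the induction hypothesis can be unavailable.
    -- The weaker bound is enough after doubling: 48n - 120 > 44(n + 1) - 160.
    have h3 : 24 * (n : ℤ) - 60 ≤ H.signlessLap.permanent := by
      rcases Nat.lt_or_ge 4 #H.internalVertices with h6 | h6
      · have h7 := h6.trans_le (card_le_univ _)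
        have h8 : (5 : ℤ) ≤ n := by rw [← hn]; exact_mod_cast h7
        have h9 := ih h6
        linarith
      · rw [← hn, ← lapPer_eq_permanent_signlessLap _ hH.bipartite]
        exact hH.lapPer_ge_of_card_internal_le (by omega) h6
    linarith
  · have h5 := ih (hI.trans h1.2)
    have h6 := hH.permanent_updateRow_ge (hI.trans h1.2) h1.1
    rw [h.permanent_signlessLap]
    linarith

theorem linear_lt_exponential {n : ℕ} (h : 5 ≤ n) :
    4 * (44 * (n : ℤ) - 160) < (4 + n) * 2 ^ n := by
  by_cases h8 : 8 ≤ n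
  · have h1 : (2 : ℤ) ^ 8 ≤ 2 ^ n := pow_le_pow_right₀ (by norm_num) h8
    nlinarith
  · interval_cases n <;> norm_num

/-- A bipartite unicyclic graph with at least five non-pendant vertices has a large permanent. -/
theorem lt_permanent_of_five_le_internal (n : ℕ) :
    ∀ {V : Type*} [Fintype V] {G : SimpleGraph V}, Fintype.card V = n → G.BipartiteUnicyclic →
      5 ≤ #G.internalVertices → 44 * (n : ℤ) - 160 < G.signlessLap.permanent := by
  induction n with
  | zero =>
    intro V _ G hn hG hI
    have := hI.trans (card_le_univ _)
    omega
  | succ n ih =>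
    intro V _ G hn hG hI
    have h5 : 5 ≤ Fintype.card V := hI.trans (card_le_univ _)
    by_cases hleaf : ∃ w, G.degree w = 1
    · obtain ⟨w, hw⟩ := hleaf
      obtain ⟨v, hv⟩ := G.exists_isPendantExtension hw
      have hH := hG.comap hw
      have hcard : Fintype.card {x // x ≠ w} = n := by
        have := Fintype.card_congr (Equiv.optionSubtypeNe w)
        rw [Fintype.card_option, hn] at this
        omega
      exact hv.lt_permanent hH hcard (by omega) hI (ih hcard hH)
    -- Without pendant vertices all degrees are at least 2, and their sum is 2n.
    · have hdeg : ∀ x, G.degree x = 2 := by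
        have h2 : ∀ x ∈ univ, 2 ≤ G.degree x := fun x _ => by
          have h1 := hG.degree_pos x (by omega)
          have h3 : G.degree x ≠ 1 := fun h => hleaf ⟨x, h⟩
          omega
        have h3 : ∑ x : V, 2 = ∑ x, G.degree x := by
          rw [hG.sum_degrees]; simp [mul_comm]
        exact fun x => ((sum_eq_sum_iff_of_le h2).1 h3 x (mem_univ x)).symm
      have h1 := permanent_signlessLap_ge_of_two_regular hdeg
      have h2 := linear_lt_exponential h5
      rw [hn] at h1 h2
      linarith

end SimpleGraph

/-! ### Hair counts up to symmetry, and the three extremal families. -/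

namespace SimpleGraph

/-- Rotation of the four-cycle. -/
def cycleFourRotate (t : Fin 4) : cycleGraph 4 ≃g cycleGraph 4 where
  toEquiv := Equiv.addRight t
  map_rel_iff' {i j} := by revert t i j; decide

/-- Reflection of the four-cycle. -/
def cycleFourReflect (t : Fin 4) : cycleGraph 4 ≃g cycleGraph 4 where
  toEquiv := Equiv.subLeft t
  map_rel_iff' {i j} := by revert t i j; decide

/-- The exceptions have all hairs at one vertex, or hairs at two vertices (opposite or adjacent),
one of which carries a single hair. Otherwise there are two hairy vertices with at least two hairs
each, or at least three hairy vertices. -/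
theorem hairyC4_classification (s : Fin 4 → ℕ) :
    (∃ σ : cycleGraph 4 ≃g cycleGraph 4, s (σ 0) = 0 ∧ s (σ 2) = 0 ∧ s (σ 3) = 0) ∨
    (∃ σ : cycleGraph 4 ≃g cycleGraph 4,
      s (σ 0) = 1 ∧ s (σ 1) = 0 ∧ 1 ≤ s (σ 2) ∧ s (σ 3) = 0) ∨
    (∃ σ : cycleGraph 4 ≃g cycleGraph 4,
      s (σ 0) = 1 ∧ 1 ≤ s (σ 1) ∧ s (σ 2) = 0 ∧ s (σ 3) = 0) ∨
    (2 ≤ ∑ i, s i ∧ 44 * ((∑ i, s i + 4 : ℕ) : ℤ) - 160 < lapPer (hairyC4 s)) := by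
  by_contra! hn
  obtain ⟨hA, hB, hC, hD⟩ := hn
  have hA' (t : Fin 4) := hA (cycleFourRotate t)
  have hB' (t : Fin 4) := hB (cycleFourRotate t)
  have hC' (t : Fin 4) := hC (cycleFourRotate t)
  -- Rotations cover all positions of the first two patterns; only the adjacent pattern
  -- distinguishes the two directions around the cycle.
  have hE' (t : Fin 4) := hC (cycleFourReflect t)
  have a0 : s 0 = 0 → s 2 = 0 → s 3 ≠ 0 := hA' 0
  have a1 : s 1 = 0 → s 3 = 0 → s 0 ≠ 0 := hA' 1
  have a2 : s 2 = 0 → s 0 = 0 → s 1 ≠ 0 := hA' 2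
  have a3 : s 3 = 0 → s 1 = 0 → s 2 ≠ 0 := hA' 3
  have b0 : s 0 = 1 → s 1 = 0 → 1 ≤ s 2 → s 3 ≠ 0 := hB' 0
  have b1 : s 1 = 1 → s 2 = 0 → 1 ≤ s 3 → s 0 ≠ 0 := hB' 1
  have b2 : s 2 = 1 → s 3 = 0 → 1 ≤ s 0 → s 1 ≠ 0 := hB' 2
  have b3 : s 3 = 1 → s 0 = 0 → 1 ≤ s 1 → s 2 ≠ 0 := hB' 3
  have c0 : s 0 = 1 → 1 ≤ s 1 → s 2 = 0 → s 3 ≠ 0 := hC' 0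
  have c1 : s 1 = 1 → 1 ≤ s 2 → s 3 = 0 → s 0 ≠ 0 := hC' 1
  have c2 : s 2 = 1 → 1 ≤ s 3 → s 0 = 0 → s 1 ≠ 0 := hC' 2
  have c3 : s 3 = 1 → 1 ≤ s 0 → s 1 = 0 → s 2 ≠ 0 := hC' 3
  have d0 : s 0 = 1 → 1 ≤ s 3 → s 2 = 0 → s 1 ≠ 0 := hE' 0
  have d1 : s 1 = 1 → 1 ≤ s 0 → s 3 = 0 → s 2 ≠ 0 := hE' 1
  have d2 : s 2 = 1 → 1 ≤ s 1 → s 0 = 0 → s 3 ≠ 0 := hE' 2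
  have d3 : s 3 = 1 → 1 ≤ s 2 → s 1 = 0 → s 0 ≠ 0 := hE' 3
  clear hA hB hC hA' hB' hC' hE'
  rw [lapPer_hairyC4, Fin.sum_univ_four] at hD
  generalize s 0 = a at *
  generalize s 1 = b at *
  generalize s 2 = c at *
  generalize s 3 = d at *
  -- The bound becomes positivity of a difference. After substituting y + 2 or y + 1 for the nonzero
  -- counts, that difference is a polynomial with nonnegative coefficients and positive constant
  -- term.
  have hlt := fun h2 h => not_le.2 (sub_pos.1 h) (hD h2)
  clear hD
  have hpair : ∀ x : ℕ, x ≠ 0 → x ≠ 1 → ∃ y, x = y + 2 := fun x h0 h1 => ⟨x - 2, by omega⟩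
  have hsucc : ∀ x : ℕ, x ≠ 0 → ∃ y, x = y + 1 := fun x h0 => ⟨x - 1, by omega⟩
  rcases eq_or_ne a 0 with ha | ha <;> rcases eq_or_ne b 0 with hb | hb <;>
    rcases eq_or_ne c 0 with hc | hc <;> rcases eq_or_ne d 0 with hd | hd
  · exact a0 ha hc hd
  · exact a2 hc ha hb
  · exact a1 hb hd ha
  · obtain ⟨c, rfl⟩ := hpair c hc (fun h => c2 h (Nat.pos_of_ne_zero hd) ha hb)
    obtain ⟨d, rfl⟩ := hpair d hd (fun h => d3 h (Nat.pos_of_ne_zero hc) hb ha)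
    subst ha hb
    clear a0 a1 a2 a3 b0 b1 b2 b3 c0 c1 c2 c3 d0 d1 d2 d3 hpair hsucc
    refine hlt (by omega) ?_
    push_cast; ring_nf; positivity
  · exact a0 ha hc hd
  · obtain ⟨b, rfl⟩ := hpair b hb (fun h => b1 h hc (Nat.pos_of_ne_zero hd) ha)
    obtain ⟨d, rfl⟩ := hpair d hd (fun h => b3 h ha (Nat.pos_of_ne_zero hb) hc)
    subst ha hc
    clear a0 a1 a2 a3 b0 b1 b2 b3 c0 c1 c2 c3 d0 d1 d2 d3 hpair hsucc
    refine hlt (by omega) ?_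
    push_cast; ring_nf; positivity
  · obtain ⟨b, rfl⟩ := hpair b hb (fun h => c1 h (Nat.pos_of_ne_zero hc) hd ha)
    obtain ⟨c, rfl⟩ := hpair c hc (fun h => d2 h (Nat.pos_of_ne_zero hb) ha hd)
    subst ha hd
    clear a0 a1 a2 a3 b0 b1 b2 b3 c0 c1 c2 c3 d0 d1 d2 d3 hpair hsucc
    refine hlt (by omega) ?_
    push_cast; ring_nf; positivity
  · obtain ⟨b, rfl⟩ := hsucc b hb
    obtain ⟨c, rfl⟩ := hsucc c hc
    obtain ⟨d, rfl⟩ := hsucc d hd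
    subst ha
    clear a0 a1 a2 a3 b0 b1 b2 b3 c0 c1 c2 c3 d0 d1 d2 d3 hpair hsucc
    refine hlt (by omega) ?_
    push_cast; ring_nf; positivity
  · exact a3 hd hb hc
  · obtain ⟨a, rfl⟩ := hpair a ha (fun h => d0 h (Nat.pos_of_ne_zero hd) hc hb)
    obtain ⟨d, rfl⟩ := hpair d hd (fun h => c3 h (Nat.pos_of_ne_zero ha) hb hc)
    subst hb hc
    clear a0 a1 a2 a3 b0 b1 b2 b3 c0 c1 c2 c3 d0 d1 d2 d3 hpair hsucc
    refine hlt (by omega) ?_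
    push_cast; ring_nf; positivity
  · obtain ⟨a, rfl⟩ := hpair a ha (fun h => b0 h hb (Nat.pos_of_ne_zero hc) hd)
    obtain ⟨c, rfl⟩ := hpair c hc (fun h => b2 h hd (Nat.pos_of_ne_zero ha) hb)
    subst hb hd
    clear a0 a1 a2 a3 b0 b1 b2 b3 c0 c1 c2 c3 d0 d1 d2 d3 hpair hsucc
    refine hlt (by omega) ?_
    push_cast; ring_nf; positivity
  · obtain ⟨a, rfl⟩ := hsucc a ha
    obtain ⟨c, rfl⟩ := hsucc c hc
    obtain ⟨d, rfl⟩ := hsucc d hd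
    subst hb
    clear a0 a1 a2 a3 b0 b1 b2 b3 c0 c1 c2 c3 d0 d1 d2 d3 hpair hsucc
    refine hlt (by omega) ?_
    push_cast; ring_nf; positivity
  · obtain ⟨a, rfl⟩ := hpair a ha (fun h => c0 h (Nat.pos_of_ne_zero hb) hc hd)
    obtain ⟨b, rfl⟩ := hpair b hb (fun h => d1 h (Nat.pos_of_ne_zero ha) hd hc)
    subst hc hd
    clear a0 a1 a2 a3 b0 b1 b2 b3 c0 c1 c2 c3 d0 d1 d2 d3 hpair hsucc
    refine hlt (by omega) ?_
    push_cast; ring_nf; positivity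
  · obtain ⟨a, rfl⟩ := hsucc a ha
    obtain ⟨b, rfl⟩ := hsucc b hb
    obtain ⟨d, rfl⟩ := hsucc d hd
    subst hc
    clear a0 a1 a2 a3 b0 b1 b2 b3 c0 c1 c2 c3 d0 d1 d2 d3 hpair hsucc
    refine hlt (by omega) ?_
    push_cast; ring_nf; positivity
  · obtain ⟨a, rfl⟩ := hsucc a ha
    obtain ⟨b, rfl⟩ := hsucc b hb
    obtain ⟨c, rfl⟩ := hsucc c hc
    subst hd
    clear a0 a1 a2 a3 b0 b1 b2 b3 c0 c1 c2 c3 d0 d1 d2 d3 hpair hsucc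
    refine hlt (by omega) ?_
    push_cast; ring_nf; positivity
  · obtain ⟨a, rfl⟩ := hsucc a ha
    obtain ⟨b, rfl⟩ := hsucc b hb
    obtain ⟨c, rfl⟩ := hsucc c hc
    obtain ⟨d, rfl⟩ := hsucc d hd
    clear a0 a1 a2 a3 b0 b1 b2 b3 c0 c1 c2 c3 d0 d1 d2 d3 hpair hsucc
    refine hlt (by omega) ?_
    push_cast; ring_nf; positivity

theorem sum_comp_iso (s : Fin 4 → ℕ) (σ : cycleGraph 4 ≃g cycleGraph 4) :
    ∑ i, s i = s (σ 0) + s (σ 1) + s (σ 2) + s (σ 3) := by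
  rw [← Fin.sum_univ_four fun i => s (σ i)]
  exact (σ.toEquiv.sum_comp s).symm

theorem IsHairyCycle.nonempty_iso_of_comp {V : Type*} [Fintype V] {G : SimpleGraph V}
    {c : Fin 4 → V} (h : G.IsHairyCycle c) (σ : cycleGraph 4 ≃g cycleGraph 4) {s : Fin 4 → ℕ}
    (hs : ∀ i, G.hairCount c (σ i) = s i) : Nonempty (G ≃g hairyC4 s) :=
  (h.comp σ).nonempty_iso fun i => by rw [hairCount_comp, hs]

/-- The last alternative records 5 ≤ n because only then does 44n - 160 dominate 24n - 60. -/
theorem BipartiteUnicyclic.classification {V : Type*} [Fintype V] {G : SimpleGraph V}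
    (hG : G.BipartiteUnicyclic) {n : ℕ} (hn : Fintype.card V = n) (h4 : 4 ≤ n) :
    Nonempty (G ≃g BGraph 2 (n - 2)) ∨ (6 ≤ n ∧ Nonempty (G ≃g C4OneGraph n)) ∨
      (6 ≤ n ∧ Nonempty (G ≃g BGraph 3 (n - 3))) ∨
      5 ≤ n ∧ 44 * (n : ℤ) - 160 < lapPer G := by
  rcases Nat.lt_or_ge 4 #G.internalVertices with hI | hI
  · have h := lt_permanent_of_five_le_internal n hn hG hI
    rw [← lapPer_eq_permanent_signlessLap _ hG.bipartite] at h
    exact .inr (.inr (.inr ⟨hn ▸ hI.trans_le (card_le_univ _), h⟩))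
  · obtain ⟨c, hc⟩ := hG.exists_isHairyCycle (by omega) hI
    have hcard := hc.card_eq
    rcases hairyC4_classification (G.hairCount c) with
      ⟨σ, h0, h2, h3⟩ | ⟨σ, h0, h1, h2, h3⟩ | ⟨σ, h0, h1, h2, h3⟩ | ⟨h2, h⟩
    · rw [sum_comp_iso _ σ] at hcard
      refine .inl (hc.nonempty_iso_of_comp σ fun i => ?_)
      fin_cases i
      · exact h0
      · change _ = n - 2 - 2; simp only [Fin.mk_one]; omega
      · exact h2
      · exact h3
    · rw [sum_comp_iso _ σ] at hcard
      refine .inr (.inl ⟨by omega, hc.nonempty_iso_of_comp σ fun i => ?_⟩)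
      fin_cases i
      · exact h0
      · exact h1
      · change _ = n - 5; change G.hairCount c (σ 2) = _; omega
      · exact h3
    · rw [sum_comp_iso _ σ] at hcard
      refine .inr (.inr (.inl ⟨by omega, hc.nonempty_iso_of_comp σ fun i => ?_⟩))
      fin_cases i
      · exact h0
      · change _ = n - 3 - 2; simp only [Fin.mk_one]; omega
      · exact h2
      · exact h3
    · refine .inr (.inr (.inr ⟨by omega, ?_⟩))
      rw [← hn, hcard, hc.lapPer_eq]
      exact h

theorem isEmpty_iso_of_lapPer_ne {V W : Type*} [Fintype V] [Fintype W] {G : SimpleGraph V}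
    {H : SimpleGraph W} (h : lapPer G ≠ lapPer H) : IsEmpty (G ≃g H) :=
  ⟨fun e => h (lapPer_iso e)⟩

theorem lapPer_BGraph_two {n : ℕ} (h : 4 ≤ n) :
    lapPer (BGraph 2 (n - 2)) = 24 * (n : ℤ) - 60 := by
  rw [BGraph, ← hairyC4, lapPer_hairyC4]
  obtain ⟨m, rfl⟩ := Nat.exists_eq_add_of_le h
  have : 4 + m - 2 - 2 = m := by omega
  simp [this]
  ring

theorem lapPer_C4OneGraph {n : ℕ} (h : 6 ≤ n) :
    lapPer (C4OneGraph n) = 40 * (n : ℤ) - 140 := by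
  rw [C4OneGraph, ← hairyC4, lapPer_hairyC4]
  obtain ⟨m, rfl⟩ := Nat.exists_eq_add_of_le h
  have : 6 + m - 5 = m + 1 := by omega
  simp [this]
  ring

theorem lapPer_BGraph_three {n : ℕ} (h : 6 ≤ n) :
    lapPer (BGraph 3 (n - 3)) = 44 * (n : ℤ) - 160 := by
  rw [BGraph, ← hairyC4, lapPer_hairyC4]
  obtain ⟨m, rfl⟩ := Nat.exists_eq_add_of_le h
  have : 6 + m - 3 - 2 = m + 1 := by omega
  simp [this]
  ring

end SimpleGraph

end

/-! ### Reading off the three smallest values. -/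

theorem theorem3p9 (n : ℕ) (hn : 4 ≤ n) :
    -- the smallest value
    ((IsBipartiteUnicyclic n (BGraph 2 (n - 2)) ∧
        lapPer (BGraph 2 (n - 2)) = 24 * (n : ℤ) - 60) ∧
      ∀ (V : Type u) [Fintype V] (G : SimpleGraph V), IsBipartiteUnicyclic n G →
        24 * (n : ℤ) - 60 ≤ lapPer G ∧
        (lapPer G = 24 * (n : ℤ) - 60 ↔ Nonempty (G ≃g BGraph 2 (n - 2)))) ∧
    -- the second smallest value
    (6 ≤ n →
      (IsBipartiteUnicyclic n (C4OneGraph n) ∧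
        IsEmpty (C4OneGraph n ≃g BGraph 2 (n - 2)) ∧
        lapPer (C4OneGraph n) = 40 * (n : ℤ) - 140) ∧
      ∀ (V : Type u) [Fintype V] (G : SimpleGraph V), IsBipartiteUnicyclic n G →
        IsEmpty (G ≃g BGraph 2 (n - 2)) →
        40 * (n : ℤ) - 140 ≤ lapPer G ∧
        (lapPer G = 40 * (n : ℤ) - 140 ↔ Nonempty (G ≃g C4OneGraph n))) ∧
    -- the third smallest value
    (6 ≤ n →
      (IsBipartiteUnicyclic n (BGraph 3 (n - 3)) ∧
        IsEmpty (BGraph 3 (n - 3) ≃g BGraph 2 (n - 2)) ∧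
        IsEmpty (BGraph 3 (n - 3) ≃g C4OneGraph n) ∧
        lapPer (BGraph 3 (n - 3)) = 44 * (n : ℤ) - 160) ∧
      ∀ (V : Type u) [Fintype V] (G : SimpleGraph V), IsBipartiteUnicyclic n G →
        IsEmpty (G ≃g BGraph 2 (n - 2)) → IsEmpty (G ≃g C4OneGraph n) →
        44 * (n : ℤ) - 160 ≤ lapPer G ∧
        (lapPer G = 44 * (n : ℤ) - 160 ↔ Nonempty (G ≃g BGraph 3 (n - 3)))) := by

  have hA := SimpleGraph.lapPer_BGraph_two hn
  have main : ∀ (V : Type u) [Fintype V] (G : SimpleGraph V), IsBipartiteUnicyclic n G →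
      Nonempty (G ≃g BGraph 2 (n - 2)) ∨ (6 ≤ n ∧ Nonempty (G ≃g C4OneGraph n)) ∨
        (6 ≤ n ∧ Nonempty (G ≃g BGraph 3 (n - 3))) ∨
        5 ≤ n ∧ 44 * (n : ℤ) - 160 < lapPer G := by
    intro V _ G hG
    obtain ⟨h1, h2⟩ := isBipartiteUnicyclic_iff.1 hG
    exact h2.classification h1 hn
  have hn' : (4 : ℤ) ≤ n := by exact_mod_cast hn
  refine ⟨⟨⟨SimpleGraph.isBipartiteUnicyclic_hairyC4 ?_, hA⟩, ?_⟩, fun h6 => ?_, fun h6 => ?_⟩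
  · simp [Fin.sum_univ_four]; omega
  · intro V _ G hG
    suffices h : Nonempty (G ≃g BGraph 2 (n - 2)) ∨ 24 * (n : ℤ) - 60 < lapPer G by
      rcases h with h | h
      · obtain ⟨e⟩ := id h
        exact ⟨by rw [SimpleGraph.lapPer_iso e, hA], fun _ => h,
          fun _ => by rw [SimpleGraph.lapPer_iso e, hA]⟩
      · refine ⟨h.le, fun h1 => absurd h1 h.ne', fun ⟨e⟩ => by rw [SimpleGraph.lapPer_iso e, hA]⟩
    rcases main V G hG with h | ⟨h6, ⟨e⟩⟩ | ⟨h6, ⟨e⟩⟩ | ⟨h5, h⟩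
    · exact .inl h
    · right; rw [SimpleGraph.lapPer_iso e, SimpleGraph.lapPer_C4OneGraph h6]; linarith
    · right; rw [SimpleGraph.lapPer_iso e, SimpleGraph.lapPer_BGraph_three h6]; linarith
    · right; linarith
  all_goals
    have hB := SimpleGraph.lapPer_C4OneGraph h6
    have hC := SimpleGraph.lapPer_BGraph_three h6
    have h6' : (6 : ℤ) ≤ n := by exact_mod_cast h6
  · refine ⟨⟨SimpleGraph.isBipartiteUnicyclic_hairyC4 ?_, SimpleGraph.isEmpty_iso_of_lapPer_ne ?_,
      hB⟩, ?_⟩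
    · simp [Fin.sum_univ_four]; omega
    · rw [hA, hB]; intro h; linarith
    intro V _ G hG hGA
    suffices h : Nonempty (G ≃g C4OneGraph n) ∨ 40 * (n : ℤ) - 140 < lapPer G by
      rcases h with h | h
      · obtain ⟨e⟩ := id h
        exact ⟨by rw [SimpleGraph.lapPer_iso e, hB], fun _ => h,
          fun _ => by rw [SimpleGraph.lapPer_iso e, hB]⟩
      · refine ⟨h.le, fun h1 => absurd h1 h.ne', fun ⟨e⟩ => by rw [SimpleGraph.lapPer_iso e, hB]⟩
    rcases main V G hG with ⟨⟨e⟩⟩ | ⟨-, h⟩ | ⟨-, ⟨e⟩⟩ | ⟨h5, h⟩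
    · exact hGA.elim e
    · exact .inl h
    · right; rw [SimpleGraph.lapPer_iso e, hC]; linarith
    · right; linarith
  · refine ⟨⟨SimpleGraph.isBipartiteUnicyclic_hairyC4 ?_, SimpleGraph.isEmpty_iso_of_lapPer_ne ?_,
      SimpleGraph.isEmpty_iso_of_lapPer_ne ?_, hC⟩, ?_⟩
    · simp [Fin.sum_univ_four]; omega
    · rw [hA, hC]; intro h; linarith
    · rw [hB, hC]; intro h; linarith
    intro V _ G hG hGA hGB
    rcases main V G hG with ⟨⟨e⟩⟩ | ⟨-, ⟨e⟩⟩ | ⟨-, h⟩ | ⟨h5, h⟩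
    · exact hGA.elim e
    · exact hGB.elim e
    · obtain ⟨e⟩ := id h
      exact ⟨by rw [SimpleGraph.lapPer_iso e, hC], fun _ => h,
          fun _ => by rw [SimpleGraph.lapPer_iso e, hC]⟩
    · exact ⟨h.le, fun h1 => absurd h1 h.ne', fun ⟨e⟩ => by rw [SimpleGraph.lapPer_iso e, hC]⟩
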